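/- Let $\Omega\subseteq\mathbb{R}^d$ be open and connected and let $\mathcal{S}_d$ be the set of symmetric $d\times d$ real matrices, with $Y\le X$ meaning that $X-Y$ is nonnegative semidefinite. Let $F:\Omega\times\mathbb{R}\times(\mathbb{R}^d\setminus\{0\})\times\mathcal{S}_d\to\mathbb{R}$ be such that (i') $F$ is upper semicontinuous and proper, i.e. $F(x,r,p,X)\le F(x,s,p,Y)$ whenever $r\le s$ and $Y\le X$; (ii') for some $\phi:(0,1]\to(0,+\infty)$, $F(x,\xi s,\xi p,\xi X)\le\phi(\xi)F(x,s,p,X)$ for all $\xi\in(0,1]$, $s\in[0,1]$, $x\in\Omega$, $p\in\mathbb{R}^d\setminus\{0\}$, $X\in\mathcal{S}_d$. Let $Z_1,\dots,Z_m:\overline\Omega\to\mathbb{R}^d$ be locally Lipschitz vector fields such that for every $x\in\Omega$, every $i$, and every $p\in\mathbb{R}^d$ with $Z_i(x)\cdot p\neq0$, $$\inf_{\gamma>0}F(x,0,p,\gamma\, p\otimes p-I)<0 .$$ A function $v\in\mathrm{LSC}(\Omega)$ is a viscosity supersolution of $F(x,v,Dv,D^2v)=0$ in $\Omega$ if $F(x,v(x),D\varphi(x),D^2\varphi(x))\ge0$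 for every $\varphi\in C^2(\Omega)$ and every minimum point $x\in\Omega$ of $v-\varphi$ in $\Omega$ with $D\varphi(x)\ne0$. Let $v$ be such a supersolution, attaining a nonpositive minimum over $\Omega$ at a point $x\in\Omega$. Consider the control system $$y'(t)=\sum_{i=1}^m Z_i(y(t))\beta_i(t),\qquad(\mathrm{S})$$ with measurable controls $\beta:[0,+\infty)\to\mathbb{R}^m$, $\sum_i\beta_i(t)^2\le1$. Say that $x_1$ is reachable from $x_0$ if there is a trajectory $y$ of (S) on some interval $[0,T]$ with $y(0)=x_0$, $y(T)=x_1$ and $y(t)\in\Omega$ for all $t\in[0,T]$. Then: 1. (Propagation of minima) $v(y)=v(x)=\min_\Omega v$ for all points $y$ reachable from $x$. 2. (Strong Minimum Principle) If (S) has the bounded time controllability property (BTC), i.e. every $x_1\in\Omega$ is reachable from every $x_0\in\Omega$, then $v$ is constant in $\Omega$. 3. In particular, $v$ is constant in $\Omega$ if the fields $Z_i$ satisfy the Hörmander condition: they are $C^\infty$ in $\Omega$ and, together with their commutators of any order, span $\mathbb{R}^d$ at every point of $\Omega$. -/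

import Mathlib

open Set MeasureTheory
open scoped ContDiff Matrix

namespace SubunitPDE

/-- Euclidean space `ℝ^d`. -/
abbrev Euc (d : ℕ) : Type := EuclideanSpace ℝ (Fin d)

/-- A second order operator `F(x, r, p, X)`. Only its values at `x ∈ Ω`, `r ∈ ℝ`, `p ≠ 0` and `X`
symmetric are ever used. -/
abbrev Operator (d : ℕ) : Type := Euc d → ℝ → Euc d → Matrix (Fin d) (Fin d) ℝ → ℝ

/-- The set `Ω × ℝ × (ℝ^d ∖ {0}) × S_d` on which operators live. -/
def operatorDomain {d : ℕ} (Ω : Set (Euc d)) :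
    Set (Euc d × ℝ × Euc d × Matrix (Fin d) (Fin d) ℝ) :=
  {q | q.1 ∈ Ω ∧ q.2.2.1 ≠ 0 ∧ q.2.2.2.IsSymm}

/-- `F` is upper semicontinuous on `Ω × ℝ × (ℝ^d ∖ {0}) × S_d`. -/
def IsUSCOperator {d : ℕ} (Ω : Set (Euc d)) (F : Operator d) : Prop :=
  UpperSemicontinuousOn (fun q : Euc d × ℝ × Euc d × Matrix (Fin d) (Fin d) ℝ =>
    F q.1 q.2.1 q.2.2.1 q.2.2.2) (operatorDomain Ω)

/-- `F` is proper: `F(x,r,p,X) ≤ F(x,s,p,Y)` if `r ≤ s` and `Y ≤ X`, where `Y ≤ X` means that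
`X - Y` is nonnegative semidefinite. -/
def IsProperOperator {d : ℕ} (Ω : Set (Euc d)) (F : Operator d) : Prop :=
  ∀ x ∈ Ω, ∀ p : Euc d, p ≠ 0 → ∀ r s : ℝ, r ≤ s →
    ∀ X Y : Matrix (Fin d) (Fin d) ℝ, X.IsSymm → Y.IsSymm → (X - Y).PosSemidef →
      F x r p X ≤ F x s p Y

/-- The reverse scaling property: for some `φ : (0,1] → (0,∞)`,
`F(x,ξs,ξp,ξX) ≤ φ(ξ) F(x,s,p,X)` for all `ξ ∈ (0,1]` and `s ∈ [0,1]`. -/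
def ReverseScaling {d : ℕ} (Ω : Set (Euc d)) (F : Operator d) : Prop :=
  ∃ φ : ℝ → ℝ, (∀ ξ ∈ Ioc (0 : ℝ) 1, 0 < φ ξ) ∧
    ∀ ξ ∈ Ioc (0 : ℝ) 1, ∀ s ∈ Icc (0 : ℝ) 1, ∀ x ∈ Ω, ∀ p : Euc d, p ≠ 0 →
      ∀ X : Matrix (Fin d) (Fin d) ℝ, X.IsSymm →
        F x (ξ * s) (ξ • p) (ξ • X) ≤ φ ξ * F x s p X

/-- The tensor product `p ⊗ p`, i.e. the matrix `(p_i p_j)`. -/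
def tensorSq {d : ℕ} (p : Euc d) : Matrix (Fin d) (Fin d) ℝ :=
  Matrix.of fun i j => p i * p j

/-- `Z` is a generalized subunit vector at `x` for `F⁻(x,r,p,X) = -F(x,-r,-p,-X)`:
`inf_{γ > 0} F(x, 0, p, γ p ⊗ p - I) < 0` for every `p` with `Z · p ≠ 0`. The infimum is taken in
the extended reals, since it may be `-∞`. -/
def IsSubunitMinus {d : ℕ} (F : Operator d) (x Z : Euc d) : Prop :=
  ∀ p : Euc d, inner ℝ Z p ≠ 0 →
    (⨅ γ : Ioi (0 : ℝ), ((F x 0 p ((γ : ℝ) • tensorSq p - 1) : ℝ) : EReal)) < 0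

/-- The Hessian matrix `D²φ(x)`. -/
noncomputable def hessian {d : ℕ} (φ : Euc d → ℝ) (x : Euc d) : Matrix (Fin d) (Fin d) ℝ :=
  Matrix.of fun i j => fderiv ℝ (fderiv ℝ φ) x
    (EuclideanSpace.single i (1 : ℝ)) (EuclideanSpace.single j (1 : ℝ))

/-- `v ∈ LSC(Ω)` is a viscosity supersolution of `F(x, v, Dv, D²v) = 0` in `Ω`, where only test
functions with nonvanishing gradient at the minimum point are used. -/
def IsViscositySupersolution {d : ℕ} (Ω : Set (Euc d)) (F : Operator d) (v : Euc d → ℝ) : Prop :=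
  LowerSemicontinuousOn v Ω ∧
    ∀ φ : Euc d → ℝ, ContDiffOn ℝ 2 φ Ω →
      ∀ x ∈ Ω, IsMinOn (fun z => v z - φ z) Ω x → gradient φ x ≠ 0 →
        0 ≤ F x (v x) (gradient φ x) (hessian φ x)

/-- Admissible controls: measurable `β : [0,∞) → ℝ^m` with `∑ β_i(t)² ≤ 1`. -/
def IsAdmissibleControl {m : ℕ} (β : ℝ → Fin m → ℝ) : Prop :=
  (∀ i, Measurable fun t => β t i) ∧ ∀ t, 0 ≤ t → ∑ i, β t i ^ 2 ≤ 1

/-- `y` is, on `[0,T]`, a trajectory in `Ω` of the control system `y' = ∑ Z_i(y) β_i` with control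
`β`, in the usual (Carathéodory) sense: `y` is continuous and solves the integral equation. -/
def IsTrajectory {d m : ℕ} (Ω : Set (Euc d)) (Z : Fin m → Euc d → Euc d)
    (β : ℝ → Fin m → ℝ) (T : ℝ) (y : ℝ → Euc d) : Prop :=
  ContinuousOn y (Icc 0 T) ∧ (∀ t ∈ Icc (0 : ℝ) T, y t ∈ Ω) ∧
    ∀ t ∈ Icc (0 : ℝ) T, y t = y 0 + ∫ s in (0 : ℝ)..t, ∑ i, β s i • Z i (y s)

/-- `x₁` is reachable from `x₀` by the control system, along a trajectory that stays in `Ω`. -/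
def Reachable {d m : ℕ} (Ω : Set (Euc d)) (Z : Fin m → Euc d → Euc d) (x₀ x₁ : Euc d) : Prop :=
  ∃ β : ℝ → Fin m → ℝ, IsAdmissibleControl β ∧ ∃ T : ℝ, 0 ≤ T ∧
    ∃ y : ℝ → Euc d, IsTrajectory Ω Z β T y ∧ y 0 = x₀ ∧ y T = x₁

/-- Bounded time controllability. -/
def BoundedTimeControllable {d m : ℕ} (Ω : Set (Euc d)) (Z : Fin m → Euc d → Euc d) : Prop :=
  ∀ x₀ ∈ Ω, ∀ x₁ ∈ Ω, Reachable Ω Z x₀ x₁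

/-- The vector fields `Z_i` and their iterated commutators of any order. -/
inductive IsIteratedBracket {d m : ℕ} (Z : Fin m → Euc d → Euc d) : (Euc d → Euc d) → Prop
  | field (i : Fin m) : IsIteratedBracket Z (Z i)
  | bracket {V W : Euc d → Euc d} (hV : IsIteratedBracket Z V) (hW : IsIteratedBracket Z W) :
      IsIteratedBracket Z (VectorField.lieBracket ℝ V W)

/-- The Hörmander condition: the fields are `C^∞` in `Ω`, and they span `ℝ^d` at each point of `Ω`
together with their commutators of any order (the Lie algebra generated by the fields is the linear
span of these). -/
def HormanderCondition {d m : ℕ} (Ω : Set (Euc d)) (Z : Fin m → Euc d → Euc d) : Prop :=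
  (∀ i, ContDiffOn ℝ ∞ (Z i) Ω) ∧
    ∀ x ∈ Ω, Submodule.span ℝ {w : Euc d | ∃ V, IsIteratedBracket Z V ∧ w = V x} = ⊤

end SubunitPDE

/-! The set `K` of points of `Ω` where `v` attains its minimum is relatively closed, by lower
semicontinuity. The PDE enters only through a Hopf-type lemma, `isTangentField_of_isSubunitMinus`:
each `Z i` is orthogonal to every proximal normal of `K`. Otherwise the subunit condition at a
normal `p` with `Z i · p ≠ 0` gives a quadratic with Hessian `γ p ⊗ p - I` that violates the
supersolution inequality near the contact point. Reverse scaling lets it be shrunk until it touches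
`v` from below.

The rest is geometry of a closed set and its tangent fields. Along a trajectory the squared distance
to `K` satisfies a Gronwall inequality, since the velocity at a nearest point is orthogonal to the
normal there and the fields are Lipschitz. So trajectories starting in `K` remain in it
(`IsTrajectory.mem_of_isTangentField`), which gives propagation and, under controllability,
constancy.

In the Hörmander case no controllability theorem is needed. Tangency passes to Lie brackets, because
the commutator of flows moves a point of `K` within `K` by `t²` times the bracket, up to `o(t²)`. A
proximal normal is then orthogonal to a spanning set and vanishes. With no nonzero proximal normals
`K` is open, and connectedness concludes. -/

namespace SubunitPDE
open Filter Topology Metric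

/-! ### Proximal normals and nearest points -/

section ProximalNormals

variable {E : Type*} [NormedAddCommGroup E] [InnerProductSpace ℝ E]

/-- `p` is a proximal normal to `K` at `k ∈ K`: locally, `K` lies outside of the ball centred at
`k + p` with radius `‖p‖`. -/
def IsProximalNormal (K : Set E) (k p : E) : Prop :=
  k ∈ K ∧ ∀ᶠ w in 𝓝 k, w ∈ K → inner ℝ p (w - k) ≤ ‖w - k‖ ^ 2 / 2

/-- The vector field `V` is orthogonal to all proximal normals to `K`. -/
def IsTangentField (K : Set E) (V : E → E) : Prop :=
  ∀ k p, IsProximalNormal K k p → inner ℝ (V k) p = 0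

theorem IsTangentField.neg {K : Set E} {V : E → E} (h : IsTangentField K V) :
    IsTangentField K (-V) := fun k p hp => by simp [h k p hp]

/-- A nearest point in a localized set gives rise to a proximal normal. -/
theorem isProximalNormal_of_infDist_eq {K : Set E} {c z k : E} {r : ℝ} (hk : k ∈ K)
    (hkr : dist k c < r) (h : infDist z (K ∩ closedBall c r) = dist z k) :
    IsProximalNormal K k (z - k) := by
  refine ⟨hk, ?_⟩
  filter_upwards [isOpen_ball.mem_nhds (show k ∈ ball c r from hkr)] with w hw hwK
  have h1 : dist z k ≤ dist z w :=
    h ▸ infDist_le_dist_of_mem ⟨hwK, ball_subset_closedBall hw⟩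
  rw [dist_eq_norm, dist_eq_norm] at h1
  have h2 : z - w = (z - k) - (w - k) := by abel
  have h3 := norm_sub_sq_real (z - k) (w - k)
  rw [← h2] at h3
  have := pow_le_pow_left₀ (norm_nonneg _) h1 2
  linarith

variable [FiniteDimensional ℝ E]

/-- Since `K` is closed only relative to `Ω`, nearest points are sought in this truncation. -/
theorem isCompact_inter_closedBall {Ω K : Set E} (hK : IsOpen (Ω \ K)) {c : E} {r : ℝ}
    (hr : closedBall c r ⊆ Ω) : IsCompact (K ∩ closedBall c r) := by
  have : K ∩ closedBall c r = closedBall c r \ (Ω \ K) := by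
    ext w
    constructor
    · rintro ⟨h1, h2⟩
      exact ⟨h2, fun h => h.2 h1⟩
    · rintro ⟨h1, h2⟩
      exact ⟨by_contra fun h => h2 ⟨hr h1, h⟩, h1⟩
  rw [this]
  exact (isCompact_closedBall c r).diff hK

/-- If every proximal normal to the relatively closed set `K` vanishes, then `K` is open. -/
theorem isOpen_of_isProximalNormal_eq_zero {Ω K : Set E} (hΩ : IsOpen Ω) (hKΩ : K ⊆ Ω)
    (hK : IsOpen (Ω \ K)) (h : ∀ k p, IsProximalNormal K k p → p = 0) : IsOpen K := by
  rw [isOpen_iff_mem_nhds]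
  intro k hk
  obtain ⟨r, hr, hrΩ⟩ := nhds_basis_closedBall.mem_iff.1 (hΩ.mem_nhds (hKΩ hk))
  refine mem_of_superset (ball_mem_nhds k (half_pos hr)) fun z hz => ?_
  have hkr : k ∈ K ∩ closedBall k r := ⟨hk, mem_closedBall_self hr.le⟩
  obtain ⟨w, hw, hwz⟩ := (isCompact_inter_closedBall hK hrΩ).exists_infDist_eq_dist ⟨k, hkr⟩ z
  have h1 : dist z w ≤ dist z k := hwz ▸ infDist_le_dist_of_mem hkr
  have h2 : dist w k < r := by
    have := dist_triangle_left w k z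
    rw [mem_ball] at hz
    linarith
  -- As `z` lies within `r / 2` of `k`, its nearest point `w` is interior to the truncating ball, so
  -- `z - w` is a genuine proximal normal of `K`; being zero, it puts `z` in `K`.
  have h3 := h w _ (isProximalNormal_of_infDist_eq hw.1 h2 hwz)
  rw [sub_eq_zero.1 h3]
  exact hw.1

end ProximalNormals

/-! ### Hopf's lemma for viscosity supersolutions -/

section Hopf

variable {d : ℕ}

/-- A quadratic function with gradient `p` and Hessian matrix `γ p ⊗ p - I` at `k`. -/
noncomputable def quadTest (γ : ℝ) (p k w : Euc d) : ℝ :=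
  inner ℝ p (w - k) + (γ * inner ℝ p (w - k) ^ 2 - ‖w - k‖ ^ 2) / 2

/-- The gradient of `quadTest`. -/
noncomputable def quadGrad (γ : ℝ) (p k w : Euc d) : Euc d :=
  p + (γ * inner ℝ p (w - k)) • p - (w - k)

theorem contDiff_quadTest (γ : ℝ) (p k : Euc d) : ContDiff ℝ 2 (quadTest γ p k) := by
  have h : ContDiff ℝ 2 fun w : Euc d => w - k := by fun_prop
  have h1 : ContDiff ℝ 2 fun w : Euc d => inner ℝ p (w - k) := contDiff_const.inner ℝ h
  exact h1.add (((contDiff_const.mul (h1.pow 2)).sub (h.norm_sq ℝ)).div_const 2)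

theorem continuous_quadGrad (γ : ℝ) (p k : Euc d) : Continuous (quadGrad γ p k) := by
  unfold quadGrad
  fun_prop

theorem hasFDerivAt_inner_sub (p k w : Euc d) :
    HasFDerivAt (fun w : Euc d => inner ℝ p (w - k)) (innerSL ℝ p) w :=
  (HasFDerivAt.comp (g := innerSL ℝ p) w (innerSL ℝ p).hasFDerivAt
    ((hasFDerivAt_id w).sub_const k)).congr_fderiv (by ext; simp)

theorem hasFDerivAt_quadTest (γ : ℝ) (p k w : Euc d) :
    HasFDerivAt (quadTest γ p k) (innerSL ℝ (quadGrad γ p k w)) w := by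
  have h0 : HasFDerivAt (fun w : Euc d => w - k) (ContinuousLinearMap.id ℝ _) w :=
    (hasFDerivAt_id w).sub_const k
  have h1 := hasFDerivAt_inner_sub p k w
  have h2 := h0.norm_sq
  have := h1.add ((((h1.pow 2).const_mul γ).sub h2).mul_const (1 / 2 : ℝ))
  refine (this.congr_fderiv ?_).congr_of_eventuallyEq (.of_forall fun z => ?_)
  · ext b
    simp [quadGrad]
    ring
  · simp [quadTest]
    ring

/-- First and second order derivatives of a function that agrees locally with a multiple of
`quadTest`. -/
theorem gradient_hessian_of_eventuallyEq {φ : Euc d → ℝ} {M ξ γ : ℝ} {p k z : Euc d}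
    (h : φ =ᶠ[𝓝 z] fun w => M + ξ * quadTest γ p k w) :
    gradient φ z = ξ • quadGrad γ p k z ∧ hessian φ z = ξ • (γ • tensorSq p - 1) := by
  have h1 : ∀ w, HasFDerivAt (fun w => M + ξ * quadTest γ p k w)
      (ξ • innerSL ℝ (quadGrad γ p k w)) w := fun w =>
    ((hasFDerivAt_quadTest γ p k w).const_mul ξ).const_add M
  constructor
  · refine HasGradientAt.gradient ?_
    rw [hasGradientAt_iff_hasFDerivAt]
    refine ((h1 z).congr_of_eventuallyEq h).congr_fderiv ?_
    ext b
    simp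
  · have hd : fderiv ℝ φ =ᶠ[𝓝 z] fun w => ξ • innerSL ℝ (quadGrad γ p k w) := by
      filter_upwards [h.eventuallyEq_nhds] with w hw
      exact ((h1 w).congr_of_eventuallyEq hw).fderiv
    have h0 : HasFDerivAt (fun w : Euc d => w - k) (ContinuousLinearMap.id ℝ _) z :=
      (hasFDerivAt_id z).sub_const k
    have h2 := hasFDerivAt_inner_sub p k z
    have hg : HasFDerivAt (quadGrad γ p k)
        ((γ • innerSL ℝ p).smulRight p - ContinuousLinearMap.id ℝ _) z :=
      (((h2.const_mul γ).smul_const p).const_add p).sub h0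
    have hφ : DifferentiableAt ℝ (fderiv ℝ φ) z := by
      have h3 : ContDiffAt ℝ 2 φ z := ContDiffAt.congr_of_eventuallyEq
        (contDiff_const.add (contDiff_const.mul (contDiff_quadTest γ p k))).contDiffAt h
      exact (h3.fderiv_right (m := 1) (by norm_num)).differentiableAt (by norm_num)
    ext i j
    have h3 : HasFDerivAt (fun w => fderiv ℝ φ w (EuclideanSpace.single j (1 : ℝ)))
        (ξ • (innerSL ℝ (EuclideanSpace.single j (1 : ℝ))).comp
          ((γ • innerSL ℝ p).smulRight p - ContinuousLinearMap.id ℝ _)) z := by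
      refine ((((innerSL ℝ (EuclideanSpace.single j (1 : ℝ))).hasFDerivAt.comp z hg).const_smul
        ξ)).congr_of_eventuallyEq ?_
      filter_upwards [hd] with w hw
      rw [hw]
      simp [real_inner_comm]
    have h4 := (hφ.hasFDerivAt.clm_apply
      (hasFDerivAt_const (EuclideanSpace.single j (1 : ℝ)) z)).unique h3
    have h5 := congrArg (fun l => l (EuclideanSpace.single i (1 : ℝ))) h4
    simp [EuclideanSpace.inner_single_left, EuclideanSpace.inner_single_right,
      PiLp.single_apply] at h5
    simp [hessian, h5, tensorSq, Matrix.one_apply]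
    exact Or.inl (by ring)

/-- A minimizer over the compact ball does no worse than `k`, so the strict gap on the sphere keeps
it inside and the bound farther out makes it global. -/
theorem isMinOn_of_ball {Ω : Set (Euc d)} {v φ : Euc d → ℝ} {M : ℝ} {k : Euc d} {r : ℝ}
    (hr : 0 < r) (hrΩ : closedBall k r ⊆ Ω) (hv : LowerSemicontinuousOn v Ω)
    (hφ : Continuous φ) (hk : v k ≤ φ k + M) (hpos : ∀ w ∈ Ω, r ≤ ‖w - k‖ → φ w + M ≤ v w)
    (hsph : ∀ w, ‖w - k‖ = r → φ w + M < v w) :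
    ∃ z ∈ ball k r, IsMinOn (fun w => v w - φ w) Ω z ∧ v z ≤ φ z + M := by
  have h1 : LowerSemicontinuousOn (fun w => v w + -φ w) (closedBall k r) :=
    (hv.mono hrΩ).add hφ.neg.continuousOn.lowerSemicontinuousOn
  obtain ⟨z, hz, hzmin⟩ := h1.exists_isMinOn ⟨k, mem_closedBall_self hr.le⟩
    (isCompact_closedBall k r)
  rw [isMinOn_iff] at hzmin
  have h2 := hzmin k (mem_closedBall_self hr.le)
  have h3 : z ∈ ball k r := by
    rw [mem_closedBall, dist_eq_norm] at hz
    rw [mem_ball, dist_eq_norm]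
    refine lt_of_le_of_ne hz fun h => ?_
    have := hsph z h
    linarith
  refine ⟨z, h3, isMinOn_iff.2 fun w hw => ?_, by linarith⟩
  by_cases hwr : ‖w - k‖ ≤ r
  · have := hzmin w (by rwa [mem_closedBall, dist_eq_norm])
    linarith
  · have := hpos w hw (not_le.1 hwr).le
    linarith

/-- **Hopf's lemma** for supersolutions: a generalized subunit field is orthogonal to the proximal
normals to the set of minimum points. -/
theorem isTangentField_of_isSubunitMinus {Ω : Set (Euc d)} (hΩ : IsOpen Ω) {F : Operator d}
    (hF_usc : IsUSCOperator Ω F) (hF_proper : IsProperOperator Ω F)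
    (hF_scaling : ReverseScaling Ω F) {Z : Euc d → Euc d} (hZ : ∀ x ∈ Ω, IsSubunitMinus F x (Z x))
    {v : Euc d → ℝ} (hv : IsViscositySupersolution Ω F v) {M : ℝ} (hM : M ≤ 0)
    (hmin : ∀ w ∈ Ω, M ≤ v w) : IsTangentField {w | w ∈ Ω ∧ v w = M} Z := by
  rintro k p₂ ⟨⟨hkΩ, hkM⟩, hprox⟩
  by_contra hne
  -- Halving the normal leaves room for strictness: on `K` it yields `⟨p, w - k⟩ ≤ ‖w - k‖² / 4`,
  -- which excludes `q w ≥ 0` for `w ≠ k` close to `k`.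
  set p : Euc d := (1 / 2 : ℝ) • p₂ with hp
  have hp₂ : p₂ = (2 : ℝ) • p := by rw [hp, smul_smul]; norm_num
  have hZp : inner ℝ (Z k) p ≠ 0 := by
    rw [hp, inner_smul_right]
    exact mul_ne_zero (by norm_num) hne
  have hp0 : p ≠ 0 := fun h => hZp (by simp [h])
  obtain ⟨⟨γ, hγ⟩, hFγ⟩ := iInf_lt_iff.1 (hZ k hkΩ p hZp)
  rw [mem_Ioi] at hγ
  have hFγ' : F k 0 p (γ • tensorSq p - 1) < 0 := by exact_mod_cast hFγ
  set X := γ • tensorSq p - 1 with hX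
  have hXs : X.IsSymm := by
    ext i j
    simp [hX, tensorSq, Matrix.one_apply, mul_comm, eq_comm]
  set q := quadTest γ p k with hq
  have hqc : Continuous q := (contDiff_quadTest γ p k).continuous
  have hq0 : q k = 0 := by simp [hq, quadTest]
  have hg0 : quadGrad γ p k k = p := by simp [quadGrad]
  have hgc := continuous_quadGrad γ p k
  have e1 : ∀ᶠ w in 𝓝 k, quadGrad γ p k w ≠ 0 := by
    refine hgc.continuousAt.eventually_ne ?_
    rwa [hg0]
  have e2 : ∀ᶠ w in 𝓝 k, w ∈ Ω := hΩ.mem_nhds hkΩ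
  -- The positive part is taken because reverse scaling is available only for `s ∈ [0,1]`.
  have e3 : ∀ᶠ w in 𝓝 k, F w (max (q w) 0) (quadGrad γ p k w) X < 0 := by
    have h := hF_usc (k, 0, p, X) ⟨hkΩ, hp0, hXs⟩ 0 hFγ'
    have hc : Continuous fun w => (w, max (q w) 0, quadGrad γ p k w, X) := by fun_prop
    have ht : Tendsto (fun w => (w, max (q w) 0, quadGrad γ p k w, X)) (𝓝 k)
        (𝓝[operatorDomain Ω] (k, 0, p, X)) := by
      refine tendsto_nhdsWithin_iff.2 ⟨?_, ?_⟩
      · have := hc.tendsto k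
        rwa [hq0, hg0, max_self] at this
      · filter_upwards [e1, e2] with w h1 h2
        exact ⟨h2, h1, hXs⟩
    exact ht.eventually h
  have e4 : ∀ᶠ w in 𝓝 k, q w < 1 := by
    refine hqc.continuousAt.eventually_lt_const ?_
    rw [hq0]
    exact one_pos
  have e5 : ∀ᶠ w in 𝓝 k, |γ * inner ℝ p (w - k)| < 1 := by
    have : Continuous fun w : Euc d => |γ * inner ℝ p (w - k)| := by fun_prop
    refine this.continuousAt.eventually_lt_const ?_
    simp
  obtain ⟨R, hR, hRs⟩ := nhds_basis_closedBall.mem_iff.1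
    (e1.and (e2.and (e3.and (e4.and (e5.and hprox)))))
  have hsep : ∀ w ∈ closedBall k R, w ≠ k → 0 ≤ q w → M < v w := by
    intro w hw hwk hqw
    obtain ⟨-, h2, -, -, h5, h6⟩ := hRs hw
    refine lt_of_le_of_ne (hmin w h2) fun hvw => ?_
    have h7 := h6 ⟨h2, hvw.symm⟩
    rw [hp₂, inner_smul_left] at h7
    simp only [hq, quadTest] at hqw
    have h8 : 0 < ‖w - k‖ ^ 2 := by
      have := norm_pos_iff.2 (sub_ne_zero.2 hwk)
      positivity
    generalize ‖w - k‖ ^ 2 = n at *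
    generalize inner ℝ p (w - k) = a at *
    rw [abs_lt] at h5
    simp only [conj_trivial] at h7
    -- Here `q w = a (1 + γ a / 2) - n / 2`. It is negative if `a ≤ 0`, and for `a ≥ 0` the bounds
    -- `γ a < 1` and `a ≤ n / 4` give at most `3n/8 - n/2`.
    rcases le_total a 0 with ha | ha
    · nlinarith
    · nlinarith
  set r := R / 2 with hr
  have hr0 : 0 < r := by positivity
  have hrR : closedBall k r ⊆ closedBall k R := closedBall_subset_closedBall (by linarith)
  have hRΩ : closedBall k R ⊆ Ω := fun w hw => (hRs hw).2.1
  obtain ⟨δ, hδ, hδv⟩ : ∃ δ > 0, ∀ w ∈ closedBall k R, r ≤ ‖w - k‖ → 0 ≤ q w → M + δ ≤ v w := by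
    set S : Set (Euc d) := closedBall k R ∩ ({w | r ≤ ‖w - k‖} ∩ {w | 0 ≤ q w}) with hS
    have hSc : IsCompact S := (isCompact_closedBall k R).inter_right
      ((isClosed_le continuous_const (by fun_prop)).inter (isClosed_le continuous_const hqc))
    rcases S.eq_empty_or_nonempty with hemp | hnon
    · refine ⟨1, one_pos, fun w h1 h2 h3 => ?_⟩
      have : w ∈ S := ⟨h1, h2, h3⟩
      simp [hemp] at this
    · obtain ⟨z, hz, hzmin⟩ := (hv.1.mono (inter_subset_left.trans hRΩ)).exists_isMinOn hnon hSc
      have hzk : z ≠ k := by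
        rintro rfl
        have := hz.2.1
        simp at this
        linarith
      refine ⟨v z - M, sub_pos.2 (hsep z hz.1 hzk hz.2.2), fun w h1 h2 h3 => ?_⟩
      have := isMinOn_iff.1 hzmin w ⟨h1, h2, h3⟩
      linarith
  -- `ξ ≤ 1` is for reverse scaling; `ξ < δ` together with `q < 1` keeps `M + ξ q` below `v` away
  -- from `k`.
  set ξ := min 1 (δ / 2) with hξ
  have hξ0 : 0 < ξ := lt_min one_pos (by positivity)
  have hξ1 : ξ ≤ 1 := min_le_left _ _
  have hξδ : ξ < δ := (min_le_right _ _).trans_lt (by linarith)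
  -- The cutoff is needed because test functions must touch at a minimum over all of `Ω`; it equals
  -- 1 near the contact point, so derivatives there are unaffected.
  let χ : ContDiffBump k := ⟨r, R, hr0, by linarith⟩
  have hχ1 : ∀ w, ‖w - k‖ ≤ r → χ w = 1 := fun w hw =>
    χ.one_of_mem_closedBall (by rwa [mem_closedBall, dist_eq_norm])
  set φ : Euc d → ℝ := fun w => χ w * (ξ * q w) with hφ
  have hφs : ContDiff ℝ 2 φ :=
    χ.contDiff.mul (contDiff_const.mul (contDiff_quadTest γ p k))
  have hfar : ∀ w ∈ Ω, r ≤ ‖w - k‖ → φ w + M ≤ v w := by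
    intro w hw hwr
    rcases le_or_gt (q w) 0 with hqw | hqw
    · have : φ w ≤ 0 := mul_nonpos_of_nonneg_of_nonpos χ.nonneg
        (mul_nonpos_of_nonneg_of_nonpos hξ0.le hqw)
      linarith [hmin w hw]
    · by_cases hwR : w ∈ closedBall k R
      · have h1 := hδv w hwR hwr hqw.le
        have h2 := (hRs hwR).2.2.2.1
        have h3 : φ w ≤ ξ * q w := mul_le_of_le_one_left (by positivity) χ.le_one
        have h4 : ξ * q w ≤ ξ := mul_le_of_le_one_right hξ0.le h2.le
        linarith
      · have : χ w = 0 := χ.zero_of_le_dist (not_le.1 hwR).le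
        simp only [hφ, this, zero_mul, zero_add]
        exact hmin w hw
  have hsph : ∀ w, ‖w - k‖ = r → φ w + M < v w := by
    intro w hwr
    have hwR : w ∈ closedBall k R := hrR (by rw [mem_closedBall, dist_eq_norm, hwr])
    have hφw : φ w = ξ * q w := by simp [hφ, hχ1 w hwr.le]
    rw [hφw]
    rcases lt_or_ge (q w) 0 with hqw | hqw
    · have := mul_neg_of_pos_of_neg hξ0 hqw
      linarith [hmin w (hRΩ hwR)]
    · have h1 := hδv w hwR hwr.ge hqw
      have h2 := (hRs hwR).2.2.2.1
      have h4 : ξ * q w ≤ ξ := mul_le_of_le_one_right hξ0.le h2.le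
      linarith
  obtain ⟨z, hz, hzmin, hvz⟩ := isMinOn_of_ball hr0 (hrR.trans hRΩ) hv.1 hφs.continuous
    (by simp [hφ, hq0, hkM]) hfar hsph
  have hφz : φ =ᶠ[𝓝 z] fun w => 0 + ξ * quadTest γ p k w := by
    filter_upwards [isOpen_ball.mem_nhds hz] with w hw
    rw [mem_ball, dist_eq_norm] at hw
    simp [hφ, hχ1 w hw.le, hq]
  obtain ⟨hgrad, hhess⟩ := gradient_hessian_of_eventuallyEq hφz
  obtain ⟨h1, h2, h3, h4, -, -⟩ := hRs (hrR (ball_subset_closedBall hz))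
  have hgne : ξ • quadGrad γ p k z ≠ 0 := smul_ne_zero hξ0.ne' h1
  have hsol := hv.2 φ hφs.contDiffOn z h2 hzmin (by rwa [hgrad])
  rw [hgrad, hhess, ← hX] at hsol
  have hXξ : (ξ • X).IsSymm := by
    rw [Matrix.IsSymm, Matrix.transpose_smul, hXs]
  -- Nonpositivity of the minimum `M` enters here. Then properness, reverse scaling and `h3` force
  -- `F < 0` at the contact point.
  have hvle : v z ≤ ξ * max (q z) 0 := by
    have h5 := hφz.self_of_nhds
    simp only [zero_add] at h5
    have h6 : ξ * q z ≤ ξ * max (q z) 0 := mul_le_mul_of_nonneg_left (le_max_left _ _) hξ0.le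
    have h7 : v z ≤ ξ * q z + M := h5 ▸ hvz
    linarith
  have hpr := hF_proper z h2 _ hgne _ _ hvle (ξ • X) (ξ • X) hXξ hXξ
    (by rw [sub_self]; exact Matrix.PosSemidef.zero)
  obtain ⟨ψ, hψ, hsc⟩ := hF_scaling
  have hsc' := hsc ξ ⟨hξ0, hξ1⟩ (max (q z) 0) ⟨le_max_right _ _, max_le h4.le zero_le_one⟩ z h2 _ h1
    X hXs
  have := mul_neg_of_pos_of_neg (hψ ξ ⟨hξ0, hξ1⟩) h3
  linarith

end Hopf

/-! ### Strong invariance by a Gronwall estimate on the squared distance -/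

section Invariance

variable {E : Type*} [NormedAddCommGroup E] [InnerProductSpace ℝ E] [FiniteDimensional ℝ E]

/-- Local strong invariance: a curve with velocity `G s (y s)` that starts in `K` stays in `K` for a
short time if `G` is orthogonal to the proximal normals to `K`. -/
theorem mem_of_isTangent_local {Ω K : Set E} (hK : IsOpen (Ω \ K)) {G : ℝ → E → E} {y : ℝ → E}
    {a b ρ L B : ℝ} {c : E} (hρ : 0 < ρ) (hΩ : closedBall c ρ ⊆ Ω) (hL : 0 ≤ L)
    (hlip : ∀ s ∈ Icc a b, ∀ w ∈ closedBall c ρ, ∀ w' ∈ closedBall c ρ,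
      ‖G s w - G s w'‖ ≤ L * ‖w - w'‖)
    (hB : ∀ s ∈ Icc a b, ∀ w ∈ closedBall c ρ, ‖G s w‖ ≤ B)
    (htan : ∀ s ∈ Icc a b, IsTangentField K (G s))
    (hy : ContinuousOn y (Icc a b)) (hyc : ∀ s ∈ Icc a b, dist (y s) c < ρ / 4)
    (hint : IntervalIntegrable (fun s => G s (y s)) volume a b)
    (hsol : ∀ t ∈ Icc a b, ∀ z ∈ Icc t b, y z - y t = ∫ s in t..z, G s (y s))
    (hya : y a = c) (hc : c ∈ K) : ∀ t ∈ Icc a b, y t ∈ K := by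
  set K' := K ∩ closedBall c ρ with hK'
  have hK'c : IsCompact K' := isCompact_inter_closedBall hK hΩ
  have hcK' : c ∈ K' := ⟨hc, mem_closedBall_self hρ.le⟩
  have hne : K'.Nonempty := ⟨c, hcK'⟩
  set e : ℝ → ℝ := fun t => infDist (y t) K' ^ 2 with he
  have hec : ContinuousOn e (Icc a b) :=
    ((continuous_infDist_pt K').comp_continuousOn hy).pow 2
  have hea : e a ≤ 0 := by simp [he, hya, infDist_zero_of_mem hcK']
  have key : ∀ t ∈ Ico a b, ∃ C : ℝ, ∀ z ∈ Ioc t b,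
      (z - t)⁻¹ * (e z - e t) ≤ 2 * L * e t + C * (z - t) := by
    intro t ht
    have htI : t ∈ Icc a b := Ico_subset_Icc_self ht
    obtain ⟨k, hk, hkd⟩ := hK'c.exists_infDist_eq_dist hne (y t)
    have h1 : dist (y t) k < ρ / 4 :=
      lt_of_le_of_lt (hkd ▸ infDist_le_dist_of_mem hcK') (hyc t htI)
    have h2 : dist k c < ρ := by
      have := dist_triangle_left k c (y t)
      linarith [hyc t htI]
    have hprox := isProximalNormal_of_infDist_eq hk.1 h2 hkd
    set p := y t - k with hp
    have het : e t = ‖p‖ ^ 2 := by simp only [he, hkd, dist_eq_norm, hp]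
    -- With `h = z - t`, expand `‖p + (y z - y t)‖²`: the cross term is at most `2 ‖p‖ L (‖p‖ + B h)
    -- h` and the last at most `B² h²`.
    refine ⟨2 * ‖p‖ * L * B + B ^ 2, fun z hz => ?_⟩
    have hzI : z ∈ Icc a b := ⟨ht.1.trans hz.1.le, hz.2⟩
    have hpos : 0 < z - t := sub_pos.2 hz.1
    have hball : ∀ s ∈ Icc a b, y s ∈ closedBall c ρ := fun s hs => by
      rw [mem_closedBall]
      linarith [hyc s hs]
    have hB' : 0 ≤ B := (norm_nonneg _).trans (hB t htI c (mem_closedBall_self hρ.le))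
    have hΔ : ∀ u ∈ Icc t z, ‖y u - y t‖ ≤ B * (u - t) := by
      intro u hu
      rw [hsol t htI u ⟨hu.1, hu.2.trans hz.2⟩]
      have := intervalIntegral.norm_integral_le_of_norm_le_const (a := t) (b := u) (C := B)
        (f := fun s => G s (y s)) fun s hs => by
          rw [uIoc_of_le hu.1] at hs
          have hs' : s ∈ Icc a b := ⟨ht.1.trans hs.1.le, hs.2.trans (hu.2.trans hz.2)⟩
          exact hB s hs' _ (hball s hs')
      rwa [abs_of_nonneg (sub_nonneg.2 hu.1)] at this
    have hinner : inner ℝ p (y z - y t) ≤ ‖p‖ * (L * (‖p‖ + B * (z - t))) * (z - t) := by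
      have hint' : IntervalIntegrable (fun s => G s (y s)) volume t z :=
        hint.mono_set (by
          rw [uIcc_of_le hz.1.le, uIcc_of_le (ht.1.trans ht.2.le)]
          exact Icc_subset_Icc ht.1 hz.2)
      rw [hsol t htI z ⟨hz.1.le, hz.2⟩]
      have h3 : inner ℝ p (∫ s in t..z, G s (y s)) = ∫ s in t..z, inner ℝ p (G s (y s)) :=
        ((innerSL ℝ p).intervalIntegral_comp_comm hint').symm
      rw [h3]
      have := intervalIntegral.norm_integral_le_of_norm_le_const (a := t) (b := z)
        (C := ‖p‖ * (L * (‖p‖ + B * (z - t))))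
        (f := fun s => inner ℝ p (G s (y s))) fun s hs => by
          rw [uIoc_of_le hz.1.le] at hs
          have hs' : s ∈ Icc a b := ⟨ht.1.trans hs.1.le, hs.2.trans hz.2⟩
          -- Tangency at the fixed nearest point `k` holds for every `s`, so no continuity of `G` in
          -- time is needed and measurable controls suffice.
          have h4 : inner ℝ p (G s (y s)) = inner ℝ p (G s (y s) - G s k) := by
            rw [inner_sub_right, real_inner_comm (G s k) p, htan s hs' k p hprox, sub_zero]
          rw [h4]
          refine (norm_inner_le_norm _ _).trans ?_
          gcongr
          refine (hlip s hs' _ (hball s hs') _ hk.2).trans ?_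
          gcongr
          have h5 : y s - k = p + (y s - y t) := by rw [hp]; abel
          rw [h5]
          refine (norm_add_le _ _).trans ?_
          gcongr
          refine (hΔ s ⟨hs.1.le, hs.2⟩).trans ?_
          gcongr
          exact hs.2
      rw [abs_of_pos hpos] at this
      exact (le_abs_self _).trans this
    have hez : e z ≤ ‖p + (y z - y t)‖ ^ 2 := by
      have h5 : infDist (y z) K' ≤ dist (y z) k := infDist_le_dist_of_mem hk
      have h6 : y z - k = p + (y z - y t) := by rw [hp]; abel
      rw [dist_eq_norm, h6] at h5
      exact pow_le_pow_left₀ infDist_nonneg h5 2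
    rw [norm_add_sq_real] at hez
    have h7 := pow_le_pow_left₀ (norm_nonneg _) (hΔ z ⟨hz.1.le, le_rfl⟩) 2
    rw [inv_mul_le_iff₀ hpos, het]
    rw [het.symm] at hez
    nlinarith
  have hgron := le_gronwallBound_of_liminf_deriv_right_le (f := e) (f' := fun t => 2 * L * e t)
    (δ := 0) (K := 2 * L) (ε := 0) hec (by
      intro t ht r hr
      obtain ⟨C, hC⟩ := key t ht
      refine Eventually.frequently ?_
      have hcont : Continuous fun z => 2 * L * e t + C * (z - t) := by fun_prop
      have h1 : ∀ᶠ z in 𝓝[>] t, 2 * L * e t + C * (z - t) < r :=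
        nhdsWithin_le_nhds (hcont.continuousAt.eventually_lt_const (by simpa using hr))
      filter_upwards [h1, Ioc_mem_nhdsGT ht.2] with z hz1 hz2
      exact (hC z hz2).trans_lt hz1) hea (fun t _ => by simp)
  intro t ht
  have h1 := hgron t ht
  rw [gronwallBound_ε0_δ0] at h1
  have h2 : infDist (y t) K' = 0 := by
    have : infDist (y t) K' ^ 2 = 0 := le_antisymm h1 (sq_nonneg _)
    exact pow_eq_zero_iff (two_ne_zero) |>.1 this
  exact ((hK'c.isClosed.mem_iff_infDist_zero hne).2 h2).1

end Invariance

/-- Locally Lipschitz vector fields are bounded and Lipschitz on small closed balls. -/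
theorem exists_closedBall_lipschitz {E : Type*} [NormedAddCommGroup E] {m : ℕ} {Ω : Set E} (hΩ : IsOpen Ω) {Z : Fin m → E → E}
    (hZ : ∀ i, LocallyLipschitzOn Ω (Z i)) {c : E} (hc : c ∈ Ω) :
    ∃ ρ > 0, closedBall c ρ ⊆ Ω ∧ ∃ L, 0 ≤ L ∧ ∃ B, 0 ≤ B ∧ ∀ i,
      (∀ w ∈ closedBall c ρ, ∀ w' ∈ closedBall c ρ, ‖Z i w - Z i w'‖ ≤ L * ‖w - w'‖) ∧
      ∀ w ∈ closedBall c ρ, ‖Z i w‖ ≤ B := by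
  have h1 : ∀ i, ∃ L : NNReal, ∃ t ∈ 𝓝 c, LipschitzOnWith L (Z i) t := fun i => by
    obtain ⟨L, t, ht, h⟩ := hZ i hc
    rw [hΩ.nhdsWithin_eq hc] at ht
    exact ⟨L, t, ht, h⟩
  choose L t ht hLt using h1
  obtain ⟨ρ, hρ, hsub⟩ := nhds_basis_closedBall.mem_iff.1
    (inter_mem (hΩ.mem_nhds hc) (iInter_mem.2 ht))
  have hlip : ∀ i, ∀ w ∈ closedBall c ρ, ∀ w' ∈ closedBall c ρ,
      ‖Z i w - Z i w'‖ ≤ (∑ j, (L j : ℝ)) * ‖w - w'‖ := fun i w hw w' hw' => by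
    refine ((hLt i).norm_sub_le (mem_iInter.1 (hsub hw).2 i) (mem_iInter.1 (hsub hw').2 i)).trans ?_
    gcongr
    exact Finset.single_le_sum (f := fun j => (L j : ℝ)) (fun j _ => (L j).2) (Finset.mem_univ i)
  refine ⟨ρ, hρ, fun w hw => (hsub hw).1, ∑ j, (L j : ℝ), Finset.sum_nonneg fun j _ => (L j).2,
    ∑ j, ‖Z j c‖ + (∑ j, (L j : ℝ)) * ρ, ?_, fun i => ⟨hlip i, fun w hw => ?_⟩⟩
  · have : 0 ≤ ∑ j, (L j : ℝ) := Finset.sum_nonneg fun j _ => (L j).2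
    positivity
  · have h2 := hlip i w hw c (mem_closedBall_self hρ.le)
    have h3 : ‖Z i c‖ ≤ ∑ j, ‖Z j c‖ :=
      Finset.single_le_sum (f := fun j => ‖Z j c‖) (fun j _ => norm_nonneg _) (Finset.mem_univ i)
    have h4 : ‖Z i w‖ ≤ ‖Z i w - Z i c‖ + ‖Z i c‖ := norm_le_norm_sub_add _ _
    have h5 : (∑ j, (L j : ℝ)) * ‖w - c‖ ≤ (∑ j, (L j : ℝ)) * ρ := by
      rw [mem_closedBall, dist_eq_norm] at hw
      exact mul_le_mul_of_nonneg_left hw (Finset.sum_nonneg fun j _ => (L j).2)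
    linarith

/-! ### Invariance under the control system -/

section ControlSystem

theorem IsAdmissibleControl.abs_le_one {m : ℕ} {β : ℝ → Fin m → ℝ} (hβ : IsAdmissibleControl β)
    {t : ℝ} (ht : 0 ≤ t) (i : Fin m) : |β t i| ≤ 1 := by
  have h1 := Finset.single_le_sum (f := fun i => β t i ^ 2) (fun j _ => sq_nonneg _)
    (Finset.mem_univ i)
  exact (sq_le_one_iff_abs_le_one _).1 (h1.trans (hβ.2 t ht))

variable {d m : ℕ} {Ω K : Set (Euc d)} {Z : Fin m → Euc d → Euc d}

theorem IsTrajectory.intervalIntegrable (hZ : ∀ i, LocallyLipschitzOn Ω (Z i))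
    {β : ℝ → Fin m → ℝ} (hβ : IsAdmissibleControl β) {T : ℝ} {y : ℝ → Euc d} (hT : 0 ≤ T)
    (hy : IsTrajectory Ω Z β T y) :
    IntervalIntegrable (fun s => ∑ i, β s i • Z i (y s)) volume 0 T := by
  rw [intervalIntegrable_iff_integrableOn_Icc_of_le hT]
  refine integrable_finsetSum _ fun i _ => ?_
  have h1 : IntegrableOn (fun s => Z i (y s)) (Icc 0 T) :=
    ((hZ i).continuousOn.comp hy.1 hy.2.1).integrableOn_Icc
  refine Integrable.bdd_smul h1 1 (hβ.1 i).aestronglyMeasurable ?_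
  filter_upwards [ae_restrict_mem measurableSet_Icc] with s hs
  exact hβ.abs_le_one hs.1 i

/-- **Strong invariance**: a relatively closed set whose proximal normals are orthogonal to the
locally Lipschitz fields `Z i` is invariant under the control system. -/
theorem IsTrajectory.mem_of_isTangentField (hΩ : IsOpen Ω) (hKΩ : K ⊆ Ω) (hK : IsOpen (Ω \ K))
    (hZ : ∀ i, LocallyLipschitzOn Ω (Z i)) (htan : ∀ i, IsTangentField K (Z i))
    {β : ℝ → Fin m → ℝ} (hβ : IsAdmissibleControl β) {T : ℝ} {y : ℝ → Euc d}
    (hy : IsTrajectory Ω Z β T y) (h0 : y 0 ∈ K) : ∀ t ∈ Icc 0 T, y t ∈ K := by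
  rcases lt_or_ge T 0 with hT | hT
  · simp [Icc_eq_empty_of_lt hT]
  have hint := hy.intervalIntegrable hZ hβ hT
  obtain ⟨hyc, hyΩ, hsol⟩ := hy
  -- Continuous induction: the times spent in `K` form a closed set, and the local result extends it
  -- to the right.
  refine IsClosed.Icc_subset_of_forall_exists_gt (s := {t | y t ∈ K}) ?_ h0 ?_
  · have := hyc.preimage_isClosed_of_isClosed isClosed_Icc hK.isClosed_compl
    convert this using 1
    ext t
    constructor
    · rintro ⟨h1, h2⟩
      exact ⟨h2, fun h => h.2 h1⟩
    · rintro ⟨h1, h2⟩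
      exact ⟨by_contra fun h => h2 ⟨hyΩ t h1, h⟩, h1⟩
  rintro t ⟨ht, ht0⟩ t' ht'
  obtain ⟨ρ, hρ, hρΩ, L, hL, B, hB, hLB⟩ := exists_closedBall_lipschitz hΩ hZ (hKΩ ht)
  have hcont : ∀ᶠ s in 𝓝[≥] t, dist (y s) (y t) < ρ / 4 := by
    have h1 : ContinuousWithinAt y (Ici t) t :=
      ((hyc t (Ico_subset_Icc_self ht0)).mono (Icc_subset_Icc_left ht0.1)).mono_of_mem_nhdsWithin
        (Icc_mem_nhdsGE ht0.2)
    exact h1 (ball_mem_nhds _ (by positivity))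
  obtain ⟨u, hu, hus⟩ := mem_nhdsGE_iff_exists_Icc_subset.1 hcont
  set b := min u (min t' T) with hb
  have htb : t < b := lt_min hu (lt_min ht' ht0.2)
  have hbT : b ≤ T := (min_le_right _ _).trans (min_le_right _ _)
  have hI : Icc t b ⊆ Icc 0 T := Icc_subset_Icc ht0.1 hbT
  have hsub : ∀ a₁ ∈ Icc 0 T, ∀ a₂ ∈ Icc 0 T,
      IntervalIntegrable (fun s => ∑ i, β s i • Z i (y s)) volume a₁ a₂ := fun a₁ h₁ a₂ h₂ =>
    hint.mono_set (uIcc_subset_uIcc (by rwa [uIcc_of_le hT]) (by rwa [uIcc_of_le hT]))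
  have hsum : ∀ s ∈ Icc t b, ∀ (f : Fin m → Euc d) (C : ℝ), (∀ i, ‖f i‖ ≤ C) →
      ‖∑ i, β s i • f i‖ ≤ m * C := fun s hs f C hf => by
    refine (norm_sum_le _ _).trans ?_
    have : ∀ i ∈ Finset.univ, ‖β s i • f i‖ ≤ C := fun i _ => by
      rw [norm_smul]
      refine (mul_le_of_le_one_left (norm_nonneg _) ?_).trans (hf i)
      exact hβ.abs_le_one (hI hs).1 i
    simpa using Finset.sum_le_sum this
  refine ⟨b, ?_, htb, (min_le_right _ _).trans (min_le_left _ _)⟩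
  refine mem_of_isTangent_local hK (G := fun s w => ∑ i, β s i • Z i w) (L := m * L) (B := m * B)
    hρ hρΩ (by positivity) ?_ ?_ ?_ (hyc.mono hI) ?_ (hsub _ (hI (left_mem_Icc.2 htb.le)) _
    (hI (right_mem_Icc.2 htb.le))) ?_ rfl ht b (right_mem_Icc.2 htb.le)
  · intro s hs w hw w' hw'
    rw [← Finset.sum_sub_distrib]
    simp_rw [← smul_sub]
    rw [mul_assoc]
    exact hsum s hs (fun i => Z i w - Z i w') _ fun i => (hLB i).1 w hw w' hw'
  · exact fun s hs w hw => hsum s hs _ _ fun i => (hLB i).2 w hw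
  · intro s _ k p hp
    simp only [sum_inner, inner_smul_left]
    exact Finset.sum_eq_zero fun i _ => by rw [htan i k p hp, mul_zero]
  · exact fun s hs => hus ⟨hs.1, hs.2.trans (min_le_left _ _)⟩
  · intro s hs z hz
    have hs' := hI hs
    have hz' := hI ⟨hs.1.trans hz.1, hz.2⟩
    have h00 : (0 : ℝ) ∈ Icc 0 T := left_mem_Icc.2 hT
    rw [hsol s hs', hsol z hz', add_sub_add_left_eq_sub,
      intervalIntegral.integral_interval_sub_left (hsub _ h00 _ hz') (hsub _ h00 _ hs')]

/-- Invariance under the flow of a single tangent vector field. -/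
theorem IsTangentField.mem_of_hasDerivAt (hΩ : IsOpen Ω) (hKΩ : K ⊆ Ω) (hK : IsOpen (Ω \ K))
    {V : Euc d → Euc d} (hV : LocallyLipschitzOn Ω V) (htan : IsTangentField K V) {T : ℝ}
    (hT : 0 ≤ T) {y : ℝ → Euc d} (hy : ∀ t ∈ Icc 0 T, HasDerivAt y (V (y t)) t)
    (hyΩ : ∀ t ∈ Icc 0 T, y t ∈ Ω) (h0 : y 0 ∈ K) : y T ∈ K := by
  have hyc : ContinuousOn y (Icc 0 T) := fun t ht => (hy t ht).continuousAt.continuousWithinAt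
  have htraj : IsTrajectory Ω (fun _ : Fin 1 => V) (fun _ _ => 1) T y := by
    refine ⟨hyc, hyΩ, fun t ht => ?_⟩
    have h1 : ∀ s ∈ uIcc 0 t, HasDerivAt y (V (y s)) s := fun s hs => by
      rw [uIcc_of_le ht.1] at hs
      exact hy s ⟨hs.1, hs.2.trans ht.2⟩
    have h2 : IntervalIntegrable (fun s => V (y s)) volume 0 t := by
      refine ContinuousOn.intervalIntegrable ?_
      rw [uIcc_of_le ht.1]
      exact (hV.continuousOn.comp hyc hyΩ).mono (Icc_subset_Icc_right ht.2)
    simp [intervalIntegral.integral_eq_sub_of_hasDerivAt h1 h2]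
  exact htraj.mem_of_isTangentField hΩ hKΩ hK (fun _ => hV) (fun _ => htan)
    ⟨fun _ => measurable_const, fun _ _ => by simp⟩ h0 T (right_mem_Icc.2 hT)

end ControlSystem

open Asymptotics

/-! ### Flows, commutators and the Hörmander condition -/

section Bracket

variable {d : ℕ} {Ω K : Set (Euc d)}

/-- Starting from points `a t = k + O(t)`, one can follow a `C¹` field `V` for time `t` staying at
distance `O(t)` from `k`. -/
theorem exists_flow_of_contDiffAt {V : Euc d → Euc d} {k A : Euc d} (hV : ContDiffAt ℝ 1 V k)
    {a : ℝ → Euc d} (hA : (fun t => a t - k - t • A) =o[𝓝[>] 0] fun t : ℝ => t) :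
    ∃ (α : ℝ → ℝ → Euc d) (C : ℝ), 0 < C ∧ ∀ᶠ t in 𝓝[>] (0 : ℝ), α t 0 = a t ∧
      ∀ s ∈ Icc 0 t, HasDerivAt (α t) (V (α t s)) s ∧ ‖α t s - k‖ ≤ C * t := by
  obtain ⟨r, hr, ε, hε, H⟩ :=
    hV.exists_forall_mem_closedBall_exists_eq_forall_mem_Ioo_hasDerivAt 0
  choose! α hα using H
  set c := ‖V k‖ + 1 with hc
  have hc0 : 0 < c := by positivity
  obtain ⟨δ, hδ, hδV⟩ : ∃ δ > 0, ∀ w ∈ closedBall k δ, ‖V w‖ < c :=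
    nhds_basis_closedBall.mem_iff.1 (hV.continuousAt.norm.eventually_lt_const (lt_add_one ‖V k‖))
  set C := ‖A‖ + 1 + c with hC
  have hC0 : 0 < C := by positivity
  have hsmall : ∀ η > 0, ∀ᶠ t in 𝓝[>] (0 : ℝ), C * t < η := fun η hη => by
    have : Continuous fun t : ℝ => C * t := by fun_prop
    exact nhdsWithin_le_nhds (this.continuousAt.eventually_lt_const (by simpa using hη))
  refine ⟨fun t => α (a t), C, hC0, ?_⟩
  filter_upwards [hsmall r hr, hsmall δ hδ, hsmall (C * ε) (by positivity), hA.bound one_pos,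
    self_mem_nhdsWithin] with t h1 h2 h3 h4 (h5 : 0 < t)
  have h3' : t < ε := lt_of_mul_lt_mul_left h3 hC0.le
  have hak : ‖a t - k‖ ≤ (‖A‖ + 1) * t := by
    have h6 : a t - k = (a t - k - t • A) + t • A := by abel
    rw [h6]
    refine (norm_add_le _ _).trans ?_
    rw [norm_smul, Real.norm_of_nonneg h5.le]
    rw [Real.norm_of_nonneg h5.le] at h4
    linarith
  have har : a t ∈ closedBall k r := by
    rw [mem_closedBall, dist_eq_norm]
    nlinarith
  obtain ⟨hα0, hαd⟩ := hα (a t) har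
  have hd : ∀ s ∈ Icc 0 t, HasDerivAt (α (a t)) (V (α (a t) s)) s := fun s hs =>
    hαd s ⟨by linarith [hs.1], by linarith [hs.2]⟩
  have hnear : ∀ s ∈ Icc 0 t, ‖α (a t) s - a t‖ ≤ c * s → ‖α (a t) s - k‖ ≤ C * t := by
    intro s hs h
    have h6 : α (a t) s - k = (α (a t) s - a t) + (a t - k) := by abel
    rw [h6]
    refine (norm_add_le _ _).trans ?_
    have : c * s ≤ c * t := mul_le_mul_of_nonneg_left hs.2 hc0.le
    rw [hC]
    linarith
  -- Barrier argument: the speed has to be below `c` only at times when the bound is attained, and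
  -- then the curve lies in the ball where `‖V‖ < c`.
  have hstay : ∀ ⦃s⦄, s ∈ Icc 0 t → ‖α (a t) s - a t‖ ≤ c * s := by
    refine image_norm_le_of_norm_deriv_right_lt_deriv_boundary
      (f := fun s => α (a t) s - a t) (f' := fun s => V (α (a t) s)) (B := fun s => c * s)
      (B' := fun _ => c) ?_ ?_ ?_ ?_ ?_
    · exact fun s hs => ((hd s hs).sub_const _).continuousAt.continuousWithinAt
    · exact fun s hs => ((hd s (Ico_subset_Icc_self hs)).sub_const _).hasDerivWithinAt
    · simp [hα0]
    · exact fun s => by simpa using (hasDerivAt_id s).const_mul c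
    · intro s hs h
      refine hδV _ ?_
      rw [mem_closedBall, dist_eq_norm]
      exact (hnear s (Ico_subset_Icc_self hs) h.le).trans h2.le
  exact ⟨hα0, fun s hs => ⟨hd s hs, hnear s hs (hstay hs)⟩⟩

/-- Second order expansion of the flow of a `C¹` field along points `k + t A + o(t)`. -/
theorem flow_isLittleO {V : Euc d → Euc d} {k A : Euc d} (hV : DifferentiableAt ℝ V k)
    {a : ℝ → Euc d} (hA : (fun t => a t - k - t • A) =o[𝓝[>] 0] fun t : ℝ => t)
    {α : ℝ → ℝ → Euc d} {C : ℝ} (hC : 0 < C) (hα : ∀ᶠ t in 𝓝[>] (0 : ℝ), α t 0 = a t ∧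
      ∀ s ∈ Icc 0 t, HasDerivAt (α t) (V (α t s)) s ∧ ‖α t s - k‖ ≤ C * t) :
    (fun t => α t t - a t - t • V k - t ^ 2 • fderiv ℝ V k (A + (1 / 2 : ℝ) • V k))
      =o[𝓝[>] 0] fun t : ℝ => t ^ 2 := by
  set D := fderiv ℝ V k with hD
  rw [isLittleO_iff]
  intro η hη
  set η₁ := min 1 (η / (2 * (1 + ‖D‖))) with hη₁
  have hη₁0 : 0 < η₁ := lt_min one_pos (by positivity)
  have hη₁1 : η₁ ≤ 1 := min_le_left _ _
  have hη₁η : η₁ * (1 + ‖D‖) ≤ η / 2 := by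
    have : η₁ ≤ η / (2 * (1 + ‖D‖)) := min_le_right _ _
    rw [le_div_iff₀ (by positivity)] at this
    linarith
  obtain ⟨δ, hδ, hδV⟩ : ∃ δ > 0, ∀ w ∈ closedBall k δ,
      ‖V w - V k - D (w - k)‖ ≤ η₁ / C * ‖w - k‖ :=
    nhds_basis_closedBall.mem_iff.1
      ((hasFDerivAt_iff_isLittleO.1 hV.hasFDerivAt).bound (div_pos hη₁0 hC))
  set C' := ‖D‖ * C + 1 with hC'
  have hC'0 : 0 < C' := by positivity
  have hsmall : ∀ c η : ℝ, 0 < η → ∀ᶠ t in 𝓝[>] (0 : ℝ), c * t < η := fun c η hη => by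
    have : Continuous fun t : ℝ => c * t := by fun_prop
    exact nhdsWithin_le_nhds (this.continuousAt.eventually_lt_const (by simpa using hη))
  filter_upwards [hα, hA.bound hη₁0, hsmall C δ hδ, hsmall (‖D‖ * C') (η / 2) (by positivity),
    self_mem_nhdsWithin] with t ⟨h0, h1⟩ h2 h3 h4 (h5 : 0 < t)
  rw [Real.norm_of_nonneg h5.le] at h2
  have hrem : ∀ s ∈ Icc 0 t, ‖V (α t s) - V k - D (α t s - k)‖ ≤ η₁ * t := fun s hs => by
    have h6 := (h1 s hs).2
    refine (hδV _ (by rw [mem_closedBall, dist_eq_norm]; linarith)).trans ?_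
    calc η₁ / C * ‖α t s - k‖ ≤ η₁ / C * (C * t) := by gcongr
      _ = η₁ * t := by field_simp
  -- This first-order estimate is fed back into the linearization of `V` at `k` to get second order,
  -- so `V` need not be `C²`.
  have hfst : ∀ s ∈ Icc 0 t, ‖α t s - s • V k - a t‖ ≤ C' * t * s := by
    have := norm_image_sub_le_of_norm_deriv_le_segment' (a := 0) (b := t) (C := C' * t)
      (f := fun s => α t s - s • V k) (f' := fun s => V (α t s) - (1 : ℝ) • V k)
      (fun s hs => ((h1 s hs).1.sub ((hasDerivAt_id s).smul_const (V k))).hasDerivWithinAt)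
      (fun s hs => by
        have hs' := Ico_subset_Icc_self hs
        have h6 : V (α t s) - (1 : ℝ) • V k = (V (α t s) - V k - D (α t s - k)) + D (α t s - k) := by
          rw [one_smul]; abel
        rw [h6]
        refine (norm_add_le _ _).trans ?_
        have h7 := D.le_opNorm_of_le (h1 s hs').2
        have h8 := hrem s hs'
        have h9 : η₁ * t ≤ 1 * t := by gcongr
        rw [hC']
        linarith)
    simpa [h0] using this
  have hmain := norm_image_sub_le_of_norm_deriv_le_segment' (a := 0) (b := t) (C := η * t)
      (f := fun s => α t s - s • V k - s • (t • D A) - (s ^ 2 / 2) • D (V k))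
      (f' := fun s => V (α t s) - (1 : ℝ) • V k - (1 : ℝ) • (t • D A) - s • D (V k))
      (fun s hs => by
        have h6 : HasDerivAt (fun s : ℝ => s ^ 2 / 2) s s := by
          simpa using (hasDerivAt_pow 2 s).div_const 2
        exact ((((h1 s hs).1.sub ((hasDerivAt_id s).smul_const (V k))).sub
          ((hasDerivAt_id s).smul_const (t • D A))).sub (h6.smul_const (D (V k)))).hasDerivWithinAt)
      (fun s hs => by
        have hs' := Ico_subset_Icc_self hs
        have h6 : V (α t s) - (1 : ℝ) • V k - (1 : ℝ) • (t • D A) - s • D (V k) =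
            (V (α t s) - V k - D (α t s - k)) +
              D ((α t s - s • V k - a t) + (a t - k - t • A)) := by
          simp only [map_add, map_sub, map_smul, one_smul]
          abel
        rw [h6]
        refine (norm_add_le _ _).trans ?_
        have h7 : ‖(α t s - s • V k - a t) + (a t - k - t • A)‖ ≤ C' * t * t + η₁ * t := by
          refine (norm_add_le _ _).trans (add_le_add ((hfst s hs').trans ?_) h2)
          gcongr
          exact hs'.2
        have h8 := D.le_opNorm_of_le h7
        have h9 := hrem s hs'
        have h10 : ‖D‖ * C' * t * t ≤ η / 2 * t := by gcongr
        have h11 : η₁ * (1 + ‖D‖) * t ≤ η / 2 * t := by gcongr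
        nlinarith)
      t (right_mem_Icc.2 h5.le)
  rw [Real.norm_of_nonneg (sq_nonneg t)]
  have h6 : α t t - a t - t • V k - t ^ 2 • D (A + (1 / 2 : ℝ) • V k) =
      (α t t - t • V k - t • (t • D A) - (t ^ 2 / 2) • D (V k)) -
      (α t 0 - (0 : ℝ) • V k - (0 : ℝ) • (t • D A) - ((0 : ℝ) ^ 2 / 2) • D (V k)) := by
    rw [h0, map_add, map_smul]
    module
  rw [h6]
  refine hmain.trans_eq ?_
  ring

/-- One leg of the commutator path. The conclusions reproduce the hypotheses with `A + V k` for `A`,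
so legs can be chained. -/
theorem IsTangentField.exists_flow_step (hΩ : IsOpen Ω) (hKΩ : K ⊆ Ω) (hK : IsOpen (Ω \ K))
    {V : Euc d → Euc d} (hV : LocallyLipschitzOn Ω V) (htan : IsTangentField K V) {k A : Euc d}
    (hk : k ∈ Ω) (hVk : ContDiffAt ℝ 1 V k) {a : ℝ → Euc d} (ha : ∀ᶠ t in 𝓝[>] 0, a t ∈ K)
    (hA : (fun t => a t - k - t • A) =o[𝓝[>] 0] fun t : ℝ => t) :
    ∃ b : ℝ → Euc d, (∀ᶠ t in 𝓝[>] 0, b t ∈ K) ∧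
      ((fun t => b t - k - t • (A + V k)) =o[𝓝[>] 0] fun t : ℝ => t) ∧
      (fun t => b t - a t - t • V k - t ^ 2 • fderiv ℝ V k (A + (1 / 2 : ℝ) • V k))
        =o[𝓝[>] 0] fun t : ℝ => t ^ 2 := by
  obtain ⟨α, C, hC, hα⟩ := exists_flow_of_contDiffAt hVk hA
  have hexp := flow_isLittleO (hVk.differentiableAt one_ne_zero) hA hC hα
  refine ⟨fun t => α t t, ?_, ?_, hexp⟩
  · obtain ⟨δ, hδ, hδΩ⟩ := nhds_basis_closedBall.mem_iff.1 (hΩ.mem_nhds hk)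
    have h1 : ∀ᶠ t in 𝓝[>] (0 : ℝ), C * t < δ := by
      have : Continuous fun t : ℝ => C * t := by fun_prop
      exact nhdsWithin_le_nhds (this.continuousAt.eventually_lt_const (by simpa using hδ))
    filter_upwards [hα, ha, h1, self_mem_nhdsWithin] with t ⟨h2, h3⟩ h4 h5 (h6 : 0 < t)
    refine htan.mem_of_hasDerivAt hΩ hKΩ hK hV h6.le (fun s hs => (h3 s hs).1)
      (fun s hs => hδΩ ?_) (h2 ▸ h4)
    rw [mem_closedBall, dist_eq_norm]
    exact (h3 s hs).2.trans h5.le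
  · have hsq : (fun t : ℝ => t ^ 2) =o[𝓝[>] 0] fun t : ℝ => t := by
      have := (isLittleO_pow_pow (𝕜 := ℝ) one_lt_two).mono (nhdsWithin_le_nhds (s := Ioi 0))
      simpa using this
    have h2 : (fun t : ℝ => t ^ 2 • fderiv ℝ V k (A + (1 / 2 : ℝ) • V k)) =o[𝓝[>] 0]
        fun t : ℝ => t := by
      refine IsBigO.trans_isLittleO (g := fun t : ℝ => t ^ 2) ?_ hsq
      exact IsBigO.of_bound _ (.of_forall fun t => by rw [norm_smul, mul_comm])
    refine (((hexp.trans hsq).add h2).add hA).congr_left fun t => ?_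
    module

/-- The Lie bracket of two tangent fields points, to first order, into `K`. -/
theorem IsTangentField.inner_lieBracket_nonpos (hΩ : IsOpen Ω) (hKΩ : K ⊆ Ω) (hK : IsOpen (Ω \ K))
    {X Y : Euc d → Euc d} (hX : LocallyLipschitzOn Ω X) (hY : LocallyLipschitzOn Ω Y)
    (hXK : IsTangentField K X) (hYK : IsTangentField K Y) {k p : Euc d}
    (hXk : ContDiffAt ℝ 1 X k) (hYk : ContDiffAt ℝ 1 Y k) (hp : IsProximalNormal K k p) :
    inner ℝ p (VectorField.lieBracket ℝ X Y k) ≤ 0 := by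
  have hk := hKΩ hp.1
  obtain ⟨y₁, hy₁, hl₁, hq₁⟩ := hXK.exists_flow_step hΩ hKΩ hK hX hk hXk (a := fun _ => k) (A := 0)
    (.of_forall fun _ => hp.1) (by simp)
  obtain ⟨y₂, hy₂, hl₂, hq₂⟩ := hYK.exists_flow_step hΩ hKΩ hK hY hk hYk hy₁ hl₁
  obtain ⟨y₃, hy₃, hl₃, hq₃⟩ := hXK.neg.exists_flow_step hΩ hKΩ hK
    (locallyLipschitzOn_neg_iff.2 hX) hk hXk.neg hy₂ hl₂
  obtain ⟨y₄, hy₄, hl₄, hq₄⟩ := hYK.neg.exists_flow_step hΩ hKΩ hK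
    (locallyLipschitzOn_neg_iff.2 hY) hk hYk.neg hy₃ hl₃
  -- The legs `X, Y, -X, -Y` start with `A = 0, X, X + Y, Y` at `k`. First-order terms cancel and
  -- the second-order ones leave `DY X - DX Y`.
  have hsum : (fun t => y₄ t - k - t ^ 2 • VectorField.lieBracket ℝ X Y k) =o[𝓝[>] 0]
      fun t : ℝ => t ^ 2 := by
    refine (((hq₁.add hq₂).add hq₃).add hq₄).congr_left fun t => ?_
    simp only [VectorField.lieBracket, fderiv_neg, Pi.neg_apply, map_add, map_smul, map_neg,
      _root_.neg_apply, map_zero]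
    module
  set B := VectorField.lieBracket ℝ X Y k with hB
  have hlim : Tendsto (fun t : ℝ => (t ^ 2)⁻¹ • (y₄ t - k)) (𝓝[>] 0) (𝓝 B) := by
    have h1 := hsum.tendsto_inv_smul_nhds_zero.add_const B
    rw [zero_add] at h1
    refine h1.congr' ?_
    filter_upwards [self_mem_nhdsWithin] with t (ht : 0 < t)
    rw [smul_sub, inv_smul_smul₀ (by positivity)]
    abel
  have hsq : Tendsto (fun t : ℝ => t ^ 2) (𝓝[>] 0) (𝓝 0) := by
    have : Continuous fun t : ℝ => t ^ 2 := by fun_prop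
    have := (this.tendsto 0).mono_left (nhdsWithin_le_nhds (s := Ioi 0))
    simpa using this
  have hy₄k : Tendsto y₄ (𝓝[>] 0) (𝓝 k) := by
    have h1 := (hsq.smul hlim).add_const k
    rw [zero_smul, zero_add] at h1
    refine h1.congr' ?_
    filter_upwards [self_mem_nhdsWithin] with t (ht : 0 < t)
    rw [smul_inv_smul₀ (by positivity)]
    abel
  -- The proximal inequality at `y₄ t ∈ K`, divided by `t²`; its quadratic right side vanishes in
  -- the limit.
  have hle : ∀ᶠ t in 𝓝[>] (0 : ℝ), inner ℝ p ((t ^ 2)⁻¹ • (y₄ t - k)) ≤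
      t ^ 2 * (‖(t ^ 2)⁻¹ • (y₄ t - k)‖ ^ 2 / 2) := by
    filter_upwards [hy₄, hy₄k.eventually hp.2, self_mem_nhdsWithin] with t h1 h2 (h3 : 0 < t)
    have h4 := h2 h1
    have h5 : 0 < t ^ 2 := by positivity
    rw [inner_smul_right, norm_smul, norm_inv, Real.norm_of_nonneg h5.le, inv_mul_le_iff₀ h5]
    refine h4.trans_eq ?_
    field_simp
  have h1 : Tendsto (fun t : ℝ => t ^ 2 * (‖(t ^ 2)⁻¹ • (y₄ t - k)‖ ^ 2 / 2)) (𝓝[>] 0)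
      (𝓝 (0 * (‖B‖ ^ 2 / 2))) := hsq.mul ((hlim.norm.pow 2).div_const 2)
  rw [zero_mul] at h1
  exact le_of_tendsto_of_tendsto (tendsto_const_nhds.inner hlim) h1 hle

/-- Antisymmetry of the bracket turns the one-sided inequality into orthogonality. -/
theorem IsTangentField.lieBracket (hΩ : IsOpen Ω) (hKΩ : K ⊆ Ω) (hK : IsOpen (Ω \ K))
    {X Y : Euc d → Euc d} (hX : LocallyLipschitzOn Ω X) (hY : LocallyLipschitzOn Ω Y)
    (hX1 : ∀ k ∈ Ω, ContDiffAt ℝ 1 X k) (hY1 : ∀ k ∈ Ω, ContDiffAt ℝ 1 Y k)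
    (hXK : IsTangentField K X) (hYK : IsTangentField K Y) :
    IsTangentField K (VectorField.lieBracket ℝ X Y) := by
  intro k p hp
  have hk := hKΩ hp.1
  rw [real_inner_comm]
  refine le_antisymm (hXK.inner_lieBracket_nonpos hΩ hKΩ hK hX hY hYK (hX1 k hk) (hY1 k hk) hp) ?_
  have := hYK.inner_lieBracket_nonpos hΩ hKΩ hK hY hX hXK (hY1 k hk) (hX1 k hk) hp
  rw [VectorField.lieBracket_swap, inner_neg_right] at this
  linarith

theorem locallyLipschitzOn_of_contDiffAt {V : Euc d → Euc d} (hV : ∀ k ∈ Ω, ContDiffAt ℝ 1 V k) :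
    LocallyLipschitzOn Ω V := fun k hk => by
  obtain ⟨L, t, ht, h⟩ := (hV k hk).exists_lipschitzOnWith
  exact ⟨L, t, nhdsWithin_le_nhds ht, h⟩

/-- Smoothness is carried through the induction because each bracket costs a derivative. -/
theorem IsIteratedBracket.isTangentField {m : ℕ} {Z : Fin m → Euc d → Euc d} (hΩ : IsOpen Ω)
    (hKΩ : K ⊆ Ω) (hK : IsOpen (Ω \ K)) (hZ : ∀ i, ContDiffOn ℝ ∞ (Z i) Ω)
    (htan : ∀ i, IsTangentField K (Z i)) {V : Euc d → Euc d} (hV : IsIteratedBracket Z V) :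
    (∀ k ∈ Ω, ContDiffAt ℝ ∞ V k) ∧ IsTangentField K V := by
  have h1 : ∀ {V : Euc d → Euc d}, (∀ k ∈ Ω, ContDiffAt ℝ ∞ V k) → ∀ k ∈ Ω, ContDiffAt ℝ 1 V k :=
    fun h k hk => (h k hk).of_le (by exact_mod_cast le_top)
  induction hV with
  | field i => exact ⟨fun k hk => (hZ i).contDiffAt (hΩ.mem_nhds hk), htan i⟩
  | bracket _ _ ihV ihW =>
    exact ⟨fun k hk => (ihV.1 k hk).lieBracket_vectorField (ihW.1 k hk) le_rfl,
      ihV.2.lieBracket hΩ hKΩ hK (locallyLipschitzOn_of_contDiffAt (h1 ihV.1))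
        (locallyLipschitzOn_of_contDiffAt (h1 ihW.1)) (h1 ihV.1) (h1 ihW.1) ihW.2⟩

/-- Under the Hörmander condition, a set to which the fields are tangent has no nonzero proximal
normals. -/
theorem HormanderCondition.isProximalNormal_eq_zero {m : ℕ} {Z : Fin m → Euc d → Euc d}
    (hH : HormanderCondition Ω Z) (hΩ : IsOpen Ω) (hKΩ : K ⊆ Ω) (hK : IsOpen (Ω \ K))
    (htan : ∀ i, IsTangentField K (Z i)) {k p : Euc d} (hp : IsProximalNormal K k p) : p = 0 := by
  have h1 : Submodule.span ℝ {w : Euc d | ∃ V, IsIteratedBracket Z V ∧ w = V k} ≤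
      LinearMap.ker (innerSL ℝ p).toLinearMap := by
    refine Submodule.span_le.2 ?_
    rintro w ⟨V, hV, rfl⟩
    have := (hV.isTangentField hΩ hKΩ hK hH.1 htan).2 k p hp
    simpa [real_inner_comm] using this
  rw [hH.2 k (hKΩ hp.1)] at h1
  have h2 : p ∈ LinearMap.ker (innerSL ℝ p).toLinearMap := h1 trivial
  simpa using h2

end Bracket
end SubunitPDE

/-! ### Propagation of minima and the strong minimum principle -/

theorem mainTheorem8 {d m : ℕ} (Ω : Set (SubunitPDE.Euc d)) (hΩo : IsOpen Ω) (hΩc : IsConnected Ω)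
    (F : SubunitPDE.Operator d)
    (hF_usc : SubunitPDE.IsUSCOperator Ω F)
    (hF_proper : SubunitPDE.IsProperOperator Ω F)
    (hF_scaling : SubunitPDE.ReverseScaling Ω F)
    (Z : Fin m → SubunitPDE.Euc d → SubunitPDE.Euc d)
    (hZ_lip : ∀ i, LocallyLipschitzOn (closure Ω) (Z i))
    (hZ_sub : ∀ i, ∀ x ∈ Ω, SubunitPDE.IsSubunitMinus F x (Z i x))
    (v : SubunitPDE.Euc d → ℝ)
    (hv : SubunitPDE.IsViscositySupersolution Ω F v)
    (x : SubunitPDE.Euc d) (hx : x ∈ Ω) (hmin : IsMinOn v Ω x) (hneg : v x ≤ 0) :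
    (∀ y, SubunitPDE.Reachable Ω Z x y → v y = v x ∧ IsMinOn v Ω y) ∧
    (SubunitPDE.BoundedTimeControllable Ω Z → ∀ y ∈ Ω, v y = v x) ∧
    (SubunitPDE.HormanderCondition Ω Z → ∀ y ∈ Ω, v y = v x) := by
  have hmin' := isMinOn_iff.1 hmin
  set K : Set (SubunitPDE.Euc d) := {w | w ∈ Ω ∧ v w = v x} with hKdef
  have hKΩ : K ⊆ Ω := fun w hw => hw.1
  have hK : IsOpen (Ω \ K) := by
    rw [isOpen_iff_mem_nhds]
    rintro w ⟨hw, hwK⟩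
    have h1 : v x < v w := lt_of_le_of_ne (hmin' w hw) fun h => hwK ⟨hw, h.symm⟩
    have h2 := hv.1 w hw _ h1
    rw [hΩo.nhdsWithin_eq hw] at h2
    filter_upwards [h2, hΩo.mem_nhds hw] with u hu huΩ
    exact ⟨huΩ, fun h => hu.ne' h.2⟩
  have htan : ∀ i, SubunitPDE.IsTangentField K (Z i) := fun i =>
    SubunitPDE.isTangentField_of_isSubunitMinus hΩo hF_usc hF_proper hF_scaling (hZ_sub i) hv hneg hmin'
  have hreach : ∀ y, SubunitPDE.Reachable Ω Z x y → v y = v x := by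
    rintro _ ⟨β, hβ, T, hT, y, hy, hy0, rfl⟩
    exact (hy.mem_of_isTangentField hΩo hKΩ hK (fun i => (hZ_lip i).mono subset_closure) htan hβ
      (hy0 ▸ ⟨hx, rfl⟩) T (right_mem_Icc.2 hT)).2
  refine ⟨fun y hy => ⟨hreach y hy, isMinOn_iff.2 fun w hw => hreach y hy ▸ hmin' w hw⟩,
    fun hB y hy => hreach y (hB x hx y hy), fun hH y hy => ?_⟩
  have hKo : IsOpen K :=
    SubunitPDE.isOpen_of_isProximalNormal_eq_zero hΩo hKΩ hK fun k p hp =>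
      hH.isProximalNormal_eq_zero hΩo hKΩ hK htan hp
  have hsub : Ω ⊆ K := hΩc.isPreconnected.subset_left_of_subset_union hKo hK disjoint_sdiff_right
    (fun w hw => (em (w ∈ K)).imp id fun h => ⟨hw, h⟩) ⟨x, hx, hx, rfl⟩
  exact (hsub hy).2
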